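/- Let $G$ be a finite simple graph, let $F$ be a maximum matching in $G$ (a matching of $G$ with the largest possible number of edges), and let $K=E(G)\setminus F$. Write $\bigcup F$ for the set of vertices incident with an edge of $F$. Paths are simple, and their edges may be arbitrary pairs of distinct vertices of $V(G)$, not necessarily edges of $G$. For a set $K'$ of such pairs, disjoint from $F$, a path is $K'$–$F$-alternating if its odd-numbered edges (the first, third, ...) belong to $K'$ and its even-numbered edges belong to $F$; it is $F$-alternating if its even-numbered edges belong to $F$, with no restriction on the odd-numbered ones. An $F$-alternating path is augmenting if it has at least one edge and neither its first nor its last vertex belongs to $\bigcup F$. Let $OR(K',F)$ be the set of vertices $v$ for which there is a $K'$–$F$-alternating path with an odd number of edges that starts at some vertex outside $\bigcup F$ and ends at $v$. A pair $e\notin F$ of distinct vertices of $V(G)$ is called enriching if $OR(K\cup\{e\},F)\supsetneqq OR(K,F)$. Then every augmenting $F$-alternating path contains an enriching edge. -/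

import Mathlib

/-- The set `⋃ F` of vertices that are incident with some edge of the edge set `F`. -/
def coveredVerts {V : Type*} (F : Set (Sym2 V)) : Set V :=
  {v | ∃ e ∈ F, v ∈ e}

/-- A matching of `G` (a subgraph in which every vertex has exactly one neighbour) is maximum if no
matching of `G` has more edges. -/
def IsMaximumMatching {V : Type*} {G : SimpleGraph V} (F : G.Subgraph) : Prop :=
  F.IsMatching ∧ ∀ M : G.Subgraph, M.IsMatching → M.edgeSet.ncard ≤ F.edgeSet.ncard

/-- `p` is a `K`-`F`-alternating path: a (simple) path on the vertex set `V`, its edges being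
arbitrary pairs of distinct vertices, whose odd-numbered edges lie in `K` and whose even-numbered
edges lie in `F`. The list `p.edges` is indexed from `0`, so the odd-numbered edges are those at
the even indices. -/
def IsAlternatingPath {V : Type*} (K F : Set (Sym2 V)) {a b : V}
    (p : (⊤ : SimpleGraph V).Walk a b) : Prop :=
  p.IsPath ∧ ∀ (i : ℕ) (hi : i < p.edges.length),
    (Even i → p.edges[i] ∈ K) ∧ (Odd i → p.edges[i] ∈ F)

/-- `p` is an augmenting `F`-alternating path: an `F`-alternating path (no restriction on the
odd-numbered edges) with at least one edge, both ends of which are not covered by `F`. -/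
def IsAugmentingPath {V : Type*} (F : Set (Sym2 V)) {a b : V}
    (p : (⊤ : SimpleGraph V).Walk a b) : Prop :=
  IsAlternatingPath Set.univ F p ∧ 0 < p.length ∧ a ∉ coveredVerts F ∧ b ∉ coveredVerts F

/-- `OR(a, K, F)`: the vertices that are oddly `K`-reachable from `a`, i.e. the last vertices of
`K`-`F`-alternating paths of odd length starting at `a`. -/
def oddReachFrom {V : Type*} (a : V) (K F : Set (Sym2 V)) : Set V :=
  {v | ∃ p : (⊤ : SimpleGraph V).Walk a v, IsAlternatingPath K F p ∧ Odd p.length}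

/-- `OR(K, F)`: the vertices that are oddly `K`-reachable from some vertex not covered by `F`. -/
def oddReach {V : Type*} (K F : Set (Sym2 V)) : Set V :=
  {v | ∃ a, a ∉ coveredVerts F ∧ v ∈ oddReachFrom a K F}

/-- The edge `e` is enriching (with respect to `K` and `F`): `e` is a pair of distinct vertices
outside `F` (so that `K ∪ {e}` is, like `K`, a set of edges disjoint from `F`), and adding `e` to
`K` strictly enlarges `OR(K, F)`. -/
def IsEnriching {V : Type*} (K F : Set (Sym2 V)) (e : Sym2 V) : Prop :=
  ¬ e.IsDiag ∧ e ∉ F ∧ oddReach K F ⊂ oddReach (K ∪ {e}) F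

/-! The matching is encoded as an involution `m` whose fixed points, the roots, are the uncovered
vertices. A base is a vertex that is evenly but not oddly reachable; a blossom is a set reached from
its base by even paths inside it. A path from a root can first meet a blossom only at the base,
along the base's matching edge: entering by a `K`-edge and running backwards to the base would make
the base oddly reachable. Hence blossoms with distinct bases are disjoint and cannot be joined by
`K`-edges (`IsBlossom.base_eq_of_bridge`). By maximality no root is oddly reachable, and then
blossoms cover all evenly reachable vertices (`EvenReachable.exists_isBlossom`).

Adding a non-enriching edge keeps all bases and blossoms, so this edge cannot join blossoms with
distinct bases either (`IsBlossom.neighbor`). If no edge of an augmenting path were enriching, then,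
walking along it, each even vertex would lie in a blossom whose base was already visited. The final
root would be in such a blossom without being its base, or else be oddly but not evenly reachable;
both are absurd (`not_oddReachable_of_forall_edge`). -/

/-- `EvenPath K m b u S`: an alternating path of even length from `b` to `u` with vertex set `S`,
whose odd-numbered edges are related by `K` and whose even-numbered edges are pairs `{y, m y}`. -/
inductive EvenPath {V : Type*} (K : V → V → Prop) (m : V → V) (b : V) : V → Set V → Prop
  | nil : EvenPath K m b b {b}
  | snoc {x y : V} {S : Set V} : EvenPath K m b x S → K x y → y ∉ S → m y ∉ S → m y ≠ y →
      EvenPath K m b (m y) (insert y (insert (m y) S))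

/-- Vertices that are ends of even alternating paths starting at a fixed point of `m`. -/
def EvenReachable {V : Type*} (K : V → V → Prop) (m : V → V) (u : V) : Prop :=
  ∃ a S, m a = a ∧ EvenPath K m a u S

/-- Vertices that are ends of odd alternating paths starting at a fixed point of `m`. -/
def OddReachable {V : Type*} (K : V → V → Prop) (m : V → V) (y : V) : Prop :=
  ∃ a x S, m a = a ∧ EvenPath K m a x S ∧ K x y ∧ y ∉ S

/-- Vertices that are evenly but not oddly reachable. -/
def IsBase {V : Type*} (K : V → V → Prop) (m : V → V) (b : V) : Prop :=
  EvenReachable K m b ∧ ¬ OddReachable K m b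

/-- A set `S` all of whose vertices are ends of even alternating paths from `b` inside `S`, where
`b` is a base. -/
def IsBlossom {V : Type*} (K : V → V → Prop) (m : V → V) (b : V) (S : Set V) : Prop :=
  IsBase K m b ∧ b ∈ S ∧ ∀ u ∈ S, ∃ T ⊆ S, EvenPath K m b u T

/-! ### Operations on even alternating paths -/

section EvenPath

variable {V : Type*} {K K' : V → V → Prop} {m : V → V} {a b u x : V} {S T : Set V}

theorem EvenPath.start_mem (h : EvenPath K m b u S) : b ∈ S := by
  induction h with
  | nil => simp
  | snoc _ _ _ _ _ ih => simp [ih]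

theorem EvenPath.end_mem (h : EvenPath K m b u S) : u ∈ S := by
  cases h <;> simp

theorem EvenPath.mono (hK : ∀ x y, K x y → K' x y) (h : EvenPath K m b u S) :
    EvenPath K' m b u S := by
  induction h with
  | nil => exact .nil
  | snoc _ h1 h2 h3 h4 ih => exact ih.snoc (hK _ _ h1) h2 h3 h4

theorem EvenPath.mate_mem (hm : ∀ v, m (m v) = v) (h : EvenPath K m b u S) {z : V} (hz : z ∈ S)
    (hzb : z ≠ b) : m z ∈ S ∧ m z ≠ b ∧ m z ≠ z := by
  induction h with
  | nil => exact absurd hz hzb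
  | @snoc x y S h h1 h2 h3 h4 ih =>
    have hb := h.start_mem
    rcases hz with rfl | rfl | hz
    · exact ⟨Or.inr (Or.inl rfl), fun e => h3 (e ▸ hb), h4⟩
    · rw [hm]
      exact ⟨Or.inl rfl, fun e => h2 (e ▸ hb), fun e => h4 e.symm⟩
    · obtain ⟨p, q⟩ := ih hz
      exact ⟨by simp [p], q⟩

theorem EvenPath.mate_mem_of_root (hm : ∀ v, m (m v) = v) (ha : m a = a)
    (h : EvenPath K m a u S) {z : V} (hz : z ∈ S) : m z ∈ S := by
  by_cases e : z = a
  · rw [e, ha]; exact h.start_mem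
  · exact (h.mate_mem hm hz e).1

theorem EvenPath.trans (h : EvenPath K m a x S) (h' : EvenPath K m x u T)
    (hST : ∀ z ∈ S, z ∈ T → z = x) : EvenPath K m a u (S ∪ T) := by
  induction h' with
  | nil => simpa [Set.insert_eq_of_mem h.end_mem] using h
  | @snoc z y T h1 h2 h3 h4 h5 ih =>
    have hx := h1.start_mem
    have e : S ∪ insert y (insert (m y) T) = insert y (insert (m y) (S ∪ T)) := by
      ext; simp
    rw [e]
    have hy : y ∉ S := fun hy => h3 (hST y hy (by simp) ▸ hx)
    have hmy : m y ∉ S := fun hy => h4 (hST _ hy (by simp) ▸ hx)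
    refine (ih fun z hz hz' => hST z hz (by simp [hz'])).snoc h2 ?_ ?_ h5 <;> simp [*]

/-- Appending a reversed even path. -/
theorem EvenPath.append_reverse (hm : ∀ v, m (m v) = v) (hK : ∀ x y, K x y → K y x)
    (h' : EvenPath K m b u T) :
    ∀ {x : V} {S : Set V}, EvenPath K m a x S → K x u → Disjoint S T →
      ∃ x' R, EvenPath K m a x' R ∧ R ⊆ S ∪ T \ {b} ∧ K x' b ∧ b ∉ R := by
  induction h' with
  | nil =>
    intro x S h hx hd
    exact ⟨x, S, h, by simp, hx, by simpa using hd⟩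
  | @snoc z y T h1 h2 h3 h4 h5 ih =>
    intro x S h hx hd
    have hb := h1.start_mem
    simp only [Set.disjoint_insert_right] at hd
    obtain ⟨d1, d2, d3⟩ := hd
    have h6 := h.snoc hx d2 (by rwa [hm]) (by rw [hm]; exact fun e => h5 e.symm)
    rw [hm] at h6
    obtain ⟨x', R, r1, r2, r3, r4⟩ := ih h6 (hK _ _ h2) (by
      simp only [Set.disjoint_insert_left]
      exact ⟨h4, h3, d3⟩)
    refine ⟨x', R, r1, fun w hw => ?_, r3, r4⟩
    have hwb : w ≠ b := fun e => r4 (e ▸ hw)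
    have := r2 hw
    simp only [Set.mem_union, Set.mem_insert_iff, Set.mem_sdiff, Set.mem_singleton_iff] at this ⊢
    tauto

/-- The initial part of a path before it first meets `Z`. -/
theorem EvenPath.exists_first_mem (h : EvenPath K m b u S) {Z : Set V} (hb : b ∉ Z)
    (hZ : ∃ z ∈ S, z ∈ Z) : ∃ x y T, EvenPath K m b x T ∧ T ⊆ S ∧ Disjoint T Z ∧ K x y ∧
      y ∉ T ∧ m y ∉ T ∧ m y ≠ y ∧ y ∈ S ∧ m y ∈ S ∧ (y ∈ Z ∨ m y ∈ Z) ∧ u ∉ T ∧ u ≠ y := by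
  induction h with
  | nil => obtain ⟨z, rfl, hz⟩ := hZ; exact absurd hz hb
  | @snoc x y S h1 h2 h3 h4 h5 ih =>
    by_cases hS : ∃ z ∈ S, z ∈ Z
    · obtain ⟨x', y', T, p1, p2, p3, p4, p5, p6, p7, p8, p9, p10, p11⟩ := ih hS
      exact ⟨x', y', T, p1, fun z hz => by simp [p2 hz], p3, p4, p5, p6, p7, by simp [p8],
        by simp [p9], p10, fun h => h4 (p2 h), fun e => h4 (e ▸ p8)⟩
    · refine ⟨x, y, S, h1, fun z hz => by simp [hz], ?_, h2, h3, h4, h5, by simp, by simp, ?_, h4, h5⟩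
      · rw [Set.disjoint_left]; exact fun z hz hz' => hS ⟨z, hz, hz'⟩
      · obtain ⟨z, rfl | rfl | hz, hz'⟩ := hZ
        · exact .inl hz'
        · exact .inr hz'
        · exact absurd ⟨z, hz, hz'⟩ hS

/-- A vertex of an even path either occurs as the end of an initial part, or is followed by its
mate, from which the rest of the path starts. -/
theorem EvenPath.split (h : EvenPath K m b u S) {z : V} (hz : z ∈ S) :
    (∃ T ⊆ S, EvenPath K m b z T) ∨
      (z ≠ b ∧ ∃ T ⊆ S, EvenPath K m (m z) u T ∧ z ∉ T ∧ b ∉ T) := by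
  induction h with
  | nil => rw [Set.mem_singleton_iff.1 hz]; exact .inl ⟨_, subset_rfl, .nil⟩
  | @snoc x y S h h1 h2 h3 h4 ih =>
    have hb := h.start_mem
    rcases hz with rfl | rfl | hz
    · refine .inr ⟨fun e => h2 (e ▸ hb), {m z}, by simp, .nil, by simpa using h4.symm, ?_⟩
      exact fun e => h3 (Set.mem_singleton_iff.1 e ▸ hb)
    · exact .inl ⟨_, subset_rfl, h.snoc h1 h2 h3 h4⟩
    · rcases ih hz with ⟨T, hT, p⟩ | ⟨hzb, T, hT, p, q, r⟩
      · exact .inl ⟨T, fun w hw => by simp [hT hw], p⟩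
      · refine .inr ⟨hzb, _, ?_, p.snoc h1 (fun e => h2 (hT e)) (fun e => h3 (hT e)) h4, ?_, ?_⟩
        · exact Set.insert_subset_insert (Set.insert_subset_insert hT)
        · have e1 : z ≠ y := fun e => h2 (e ▸ hz)
          have e2 : z ≠ m y := fun e => h3 (e ▸ hz)
          simp [e1, e2, q]
        · have e1 : b ≠ y := fun e => h2 (e ▸ hb)
          have e2 : b ≠ m y := fun e => h3 (e ▸ hb)
          simp [e1, e2, r]

/-- The final part of a path after it last leaves `U`. -/
theorem EvenPath.exists_last_mem {U : Set V} (ha : m a = a) (haU : a ∈ U)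
    (hU : ∀ y, y ∈ U → m y ∉ U → ¬ OddReachable K m y) (h : EvenPath K m a u S) (hu : u ∉ U) :
    ∃ s ∈ U, ∃ T ⊆ S, EvenPath K m s u T ∧ ∀ z ∈ T, z ∈ U → z = s := by
  induction h with
  | nil => exact absurd haU hu
  | @snoc x y S h h1 h2 h3 h4 ih =>
    have hy : y ∉ U := fun hy => hU y hy hu ⟨a, x, S, ha, h, h1, h2⟩
    by_cases hx : x ∈ U
    · have hxS := h.end_mem
      refine ⟨x, hx, insert y (insert (m y) {x}), ?_, EvenPath.nil.snoc h1 ?_ ?_ h4, ?_⟩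
      · intro z; simp only [Set.mem_insert_iff, Set.mem_singleton_iff]
        rintro (h | h | rfl) <;> simp [*]
      · rintro rfl; exact h2 hxS
      · intro e; rw [Set.mem_singleton_iff.1 e] at h3; exact h3 hxS
      · rintro z (rfl | rfl | hz) hzU
        · exact absurd hzU hy
        · exact absurd hzU hu
        · exact hz
    · obtain ⟨s, hs, T, hT, p, q⟩ := ih hx
      refine ⟨s, hs, _, ?_, p.snoc h1 (fun e => h2 (hT e)) (fun e => h3 (hT e)) h4, ?_⟩
      · exact Set.insert_subset_insert (Set.insert_subset_insert hT)
      · rintro z (rfl | rfl | hz) hzU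
        · exact absurd hzU hy
        · exact absurd hzU hu
        · exact q z hz hzU

theorem OddReachable.mono (hK : ∀ x y, K x y → K' x y) (h : OddReachable K m u) :
    OddReachable K' m u := by
  obtain ⟨a, x, S, h1, h2, h3, h4⟩ := h
  exact ⟨a, x, S, h1, h2.mono hK, hK _ _ h3, h4⟩

theorem EvenReachable.mono (hK : ∀ x y, K x y → K' x y) (h : EvenReachable K m u) :
    EvenReachable K' m u := by
  obtain ⟨a, S, h1, h2⟩ := h
  exact ⟨a, S, h1, h2.mono hK⟩

theorem OddReachable.mate (hm : ∀ v, m (m v) = v) (h : OddReachable K m u) (hu : m u ≠ u) :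
    EvenReachable K m (m u) := by
  obtain ⟨a, x, S, h1, h2, h3, h4⟩ := h
  refine ⟨a, _, h1, h2.snoc h3 h4 (fun e => h4 ?_) hu⟩
  have := h2.mate_mem_of_root hm h1 e
  rwa [hm] at this

theorem EvenReachable.mate (hm : ∀ v, m (m v) = v) (h : EvenReachable K m u) (hu : m u ≠ u) :
    OddReachable K m (m u) := by
  obtain ⟨a, S, h1, h2⟩ := h
  cases h2 with
  | nil => exact absurd h1 hu
  | @snoc x y S h p1 p2 p3 p4 => rw [hm]; exact ⟨a, x, S, h1, h, p1, p2⟩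

theorem EvenPath.mem_reachable (ha : m a = a) (h : EvenPath K m a u S) {z : V} (hz : z ∈ S) :
    EvenReachable K m z ∨ OddReachable K m z := by
  induction h with
  | nil => rw [Set.mem_singleton_iff.1 hz]; exact .inl ⟨a, _, ha, .nil⟩
  | @snoc x y S h h1 h2 h3 h4 ih =>
    rcases hz with rfl | rfl | hz
    · exact .inr ⟨a, x, S, ha, h, h1, h2⟩
    · exact .inl ⟨a, _, ha, h.snoc h1 h2 h3 h4⟩
    · exact ih hz

end EvenPath

/-! ### Bases and blossoms -/

section Blossom

variable {V : Type*} {K K' : V → V → Prop} {m : V → V} {a b b' s u w x y : V} {S S' T Q : Set V}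

theorem IsBase.isBlossom (h : IsBase K m b) : IsBlossom K m b {b} :=
  ⟨h, rfl, fun u hu => ⟨{b}, subset_rfl, by rw [Set.mem_singleton_iff.1 hu]; exact .nil⟩⟩

theorem IsBlossom.mate_mem (hm : ∀ v, m (m v) = v) (h : IsBlossom K m b S) (hu : u ∈ S)
    (hub : u ≠ b) : m u ∈ S ∧ m u ≠ b ∧ m u ≠ u := by
  obtain ⟨T, hT, p⟩ := h.2.2 u hu
  obtain ⟨h1, h2⟩ := p.mate_mem hm p.end_mem hub
  exact ⟨hT h1, h2⟩

/-- A path from a root cannot be continued into a blossom if it does not pass through its base. -/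
theorem IsBlossom.not_enter (hm : ∀ v, m (m v) = v) (hK : ∀ x y, K x y → K y x)
    (h : IsBlossom K m b S) (ha : m a = a) (p : EvenPath K m a x Q) (hxy : K x y) (hy : y ∈ S)
    (hd : Disjoint Q S) : False := by
  obtain ⟨T, hT, q⟩ := h.2.2 y hy
  obtain ⟨x', R, r1, -, r2, r3⟩ := q.append_reverse hm hK p hxy (hd.mono_right hT)
  exact h.1.2 ⟨a, x', R, ha, r1, r2, r3⟩

/-- A path from a root first meets a blossom at its base. -/
theorem IsBlossom.exists_path_to_base (hm : ∀ v, m (m v) = v) (hK : ∀ x y, K x y → K y x)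
    (h : IsBlossom K m b S) (ha : m a = a) (p : EvenPath K m a u Q) (hQ : ∃ z ∈ Q, z ∈ S) :
    ∃ Q' ⊆ Q, EvenPath K m a b Q' ∧ (∀ z ∈ Q', z ∈ S → z = b) ∧ (u ∈ Q' → u = b) := by
  by_cases haS : a ∈ S
  · have hab : a = b := by
      by_contra hab
      exact (h.mate_mem hm haS hab).2.2 ha
    subst hab
    exact ⟨{a}, by simpa using p.start_mem, .nil, by simp, by simp⟩
  · obtain ⟨x, y, T, p1, p2, p3, p4, p5, p6, p7, p8, p9, p10, p11, p12⟩ :=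
      p.exists_first_mem haS hQ
    -- The blossom cannot be entered by a `K`-edge, so it is entered by a matching edge, and only
    -- the base can have its mate outside.
    have hy : y ∉ S := fun hy => h.not_enter hm hK ha p1 p4 hy p3
    have hmy : m y ∈ S := p10.resolve_left hy
    have hb : m y = b := by
      by_contra hb
      have := (h.mate_mem hm hmy hb).1
      rw [hm] at this
      exact hy this
    subst hb
    refine ⟨_, ?_, p1.snoc p4 p5 p6 p7, ?_, ?_⟩
    · rintro z (rfl | rfl | hz)
      exacts [p8, p9, p2 hz]
    · rintro z (rfl | rfl | hz) hzS
      exacts [absurd hzS hy, rfl, absurd hzS (Set.disjoint_left.1 p3 hz)]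
    · rintro (h | h | h)
      exacts [absurd h p12, h, absurd h p11]

/-- An even path from a root to the mate of `u`, through the base, has the matching edge at `u` as
its last edge; dropping that edge leaves an odd path to `u`. -/
theorem IsBlossom.oddReachable (hm : ∀ v, m (m v) = v) (hK : ∀ x y, K x y → K y x)
    (h : IsBlossom K m b S) (hu : u ∈ S) (hub : u ≠ b) : OddReachable K m u := by
  obtain ⟨a, Q, ha, p⟩ := h.1.1
  obtain ⟨Q', -, p', hQ', -⟩ := h.exists_path_to_base hm hK ha p ⟨b, p.end_mem, h.2.1⟩
  obtain ⟨h1, h2, h3⟩ := h.mate_mem hm hu hub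
  obtain ⟨T, hT, q⟩ := h.2.2 _ h1
  have := EvenReachable.mate hm ⟨a, _, ha, p'.trans q fun z hz hz' => hQ' z hz (hT hz')⟩
    (by rw [hm]; exact h3.symm)
  rwa [hm] at this

theorem IsBlossom.evenReachable (hm : ∀ v, m (m v) = v) (hK : ∀ x y, K x y → K y x)
    (h : IsBlossom K m b S) (hu : u ∈ S) : EvenReachable K m u := by
  obtain ⟨a, Q, ha, p⟩ := h.1.1
  obtain ⟨Q', -, p', hQ', -⟩ := h.exists_path_to_base hm hK ha p ⟨b, p.end_mem, h.2.1⟩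
  obtain ⟨T, hT, q⟩ := h.2.2 _ hu
  exact ⟨a, _, ha, p'.trans q fun z hz hz' => hQ' z hz (hT hz')⟩

/-- Of two blossoms with distinct bases, one can be reached by a path avoiding the other. -/
theorem IsBlossom.exists_path_avoiding (hm : ∀ v, m (m v) = v) (hK : ∀ x y, K x y → K y x)
    (h : IsBlossom K m b S) (h' : IsBlossom K m b' S') (hbb : b ≠ b') :
    (∃ a Q, m a = a ∧ EvenPath K m a b Q ∧ (∀ z ∈ Q, z ∈ S → z = b) ∧ Disjoint Q S') ∨
    (∃ a Q, m a = a ∧ EvenPath K m a b' Q ∧ (∀ z ∈ Q, z ∈ S' → z = b') ∧ Disjoint Q S) := by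
  obtain ⟨a, Q₀, ha, p₀⟩ := h.1.1
  obtain ⟨Q, -, p, hQ, -⟩ := h.exists_path_to_base hm hK ha p₀ ⟨b, p₀.end_mem, h.2.1⟩
  by_cases hd : ∃ z ∈ Q, z ∈ S'
  · obtain ⟨Q', hQQ, p', hQ', hb⟩ := h'.exists_path_to_base hm hK ha p hd
    refine .inr ⟨a, Q', ha, p', hQ', Set.disjoint_left.2 fun z hz hzS => ?_⟩
    have := hQ z (hQQ hz) hzS
    subst this
    exact hbb (hb hz)
  · exact .inl ⟨a, Q, ha, p, hQ, Set.disjoint_left.2 fun z hz hz' => hd ⟨z, hz, hz'⟩⟩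

/-- A path from a root reaches one base while avoiding the other blossom. Continued inside the first
blossom towards a common vertex, it must meet the second at its base `b'`. Then `b'` is a non-base
vertex of the first blossom, hence oddly reachable. -/
theorem IsBlossom.disjoint (hm : ∀ v, m (m v) = v) (hK : ∀ x y, K x y → K y x)
    (h : IsBlossom K m b S) (h' : IsBlossom K m b' S') (hbb : b ≠ b') : Disjoint S S' := by
  wlog hQ : ∃ a Q, m a = a ∧ EvenPath K m a b Q ∧ (∀ z ∈ Q, z ∈ S → z = b) ∧ Disjoint Q S'
    generalizing b b' S S'
  · exact (this h' h hbb.symm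
      ((h.exists_path_avoiding hm hK h' hbb).resolve_left hQ)).symm
  obtain ⟨a, Q, ha, p, hQ, hd⟩ := hQ
  refine Set.disjoint_left.2 fun z hz hz' => ?_
  obtain ⟨T, hT, q⟩ := h.2.2 z hz
  have hb : b ∉ S' := Set.disjoint_left.1 hd p.end_mem
  obtain ⟨x, y, T', p1, p2, p3, p4, p5, p6, p7, p8, p9, p10, -⟩ :=
    q.exists_first_mem hb ⟨z, q.end_mem, hz'⟩
  have p' := p.trans p1 fun z hz hz' => hQ z hz (hT (p2 hz'))
  have hy : y ∉ S' := fun hy => h'.not_enter hm hK ha p' p4 hy (Set.disjoint_union_left.2 ⟨hd, p3⟩)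
  have hmy := p10.resolve_left hy
  have hyb : m y = b' := by
    by_contra hb
    have := (h'.mate_mem hm hmy hb).1
    rw [hm] at this
    exact hy this
  exact h'.1.2 (hyb ▸ h.oddReachable hm hK (hT p9) (fun e => hbb (e.symm.trans hyb)))

/-- If the root path to `b` misses the bridge, then going on through `S` and the bridge enters `S'`
by a `K`-edge. Otherwise, from their first common pair the bridge can be followed in one of its two
directions, entering `S` or `S'` by a `K`-edge. -/
theorem IsBlossom.not_bridge_of_path (hm : ∀ v, m (m v) = v) (hK : ∀ x y, K x y → K y x)
    (h : IsBlossom K m b S) (h' : IsBlossom K m b' S') (hSS : Disjoint S S')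
    (hs : s ∈ S) (q : EvenPath K m s w T) (hTS : ∀ z ∈ T, z ∈ S → z = s) (hTS' : Disjoint T S')
    (hwx : K w x) (hx : x ∈ S') (ha : m a = a) (p : EvenPath K m a b Q)
    (hQ : ∀ z ∈ Q, z ∈ S → z = b) (hQS : Disjoint Q S') : False := by
  obtain ⟨T₁, hT₁, q₁⟩ := h.2.2 s hs
  by_cases hQT : ∃ z ∈ Q, z ∈ T \ {s}
  · have haT : a ∉ T \ {s} := fun h => (q.mate_mem hm h.1 h.2).2.2 ha
    obtain ⟨x₁, y, Q', p1, p2, p3, p4, p5, p6, p7, p8, p9, p10, p11, p12⟩ :=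
      p.exists_first_mem haT hQT
    have hy : y ∈ T \ {s} := by
      refine p10.elim id fun h => ?_
      have := q.mate_mem hm h.1 h.2
      rw [hm] at this
      exact ⟨this.1, this.2.1⟩
    have hmy := (q.mate_mem hm hy.1 hy.2).1
    have hQ'S : Disjoint Q' S := Set.disjoint_left.2 fun z hz hzS => p11 (hQ z (p2 hz) hzS ▸ hz)
    have hQ'T : Disjoint Q' T := Set.disjoint_left.2 fun z hz hzT =>
      Set.disjoint_left.1 p3 hz ⟨hzT, fun e => Set.disjoint_left.1 hQ'S hz
        (Set.mem_singleton_iff.1 e ▸ hs)⟩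
    rcases q.split hy.1 with ⟨T', hT', q'⟩ | ⟨-, T', hT', q', hyT', hsT'⟩
    · obtain ⟨x', R, r1, r2, r3, r4⟩ := q'.append_reverse hm hK p1 p4 (hQ'T.mono_right hT')
      refine h.not_enter hm hK ha r1 r3 hs (Set.disjoint_left.2 fun z hz hzS => ?_)
      rcases r2 hz with hz | hz
      · exact Set.disjoint_left.1 hQ'S hz hzS
      · exact hz.2 (hTS z (hT' hz.1) hzS)
    · have p' := (p1.snoc p4 p5 p6 p7).trans q' (by
        rintro z (rfl | rfl | hz) hz'
        · exact absurd hz' hyT'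
        · rfl
        · exact absurd (hT' hz') (Set.disjoint_left.1 hQ'T hz))
      refine h'.not_enter hm hK ha p' hwx hx (Set.disjoint_left.2 ?_)
      rintro z ((rfl | rfl | hz) | hz)
      · exact Set.disjoint_left.1 hTS' hy.1
      · exact Set.disjoint_left.1 hTS' hmy
      · exact Set.disjoint_left.1 hQS (p2 hz)
      · exact Set.disjoint_left.1 hTS' (hT' hz)
  · have p' := (p.trans q₁ fun z hz hz' => hQ z hz (hT₁ hz')).trans q (by
      rintro z (hz | hz) hz'
      · by_contra e
        exact hQT ⟨z, hz, hz', e⟩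
      · exact hTS z hz' (hT₁ hz))
    exact h'.not_enter hm hK ha p' hwx hx (Set.disjoint_union_left.2
      ⟨Set.disjoint_union_left.2 ⟨hQS, hSS.mono_left hT₁⟩, hTS'⟩)

/-- Blossoms that are joined by an alternating path whose first and last edges are in `K` have the
same base. -/
theorem IsBlossom.base_eq_of_bridge (hm : ∀ v, m (m v) = v) (hK : ∀ x y, K x y → K y x)
    (h : IsBlossom K m b S) (h' : IsBlossom K m b' S')
    (hs : s ∈ S) (q : EvenPath K m s w T) (hTS : ∀ z ∈ T, z ∈ S → z = s)
    (hTS' : b ≠ b' → Disjoint T S')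
    (hwx : K w x) (hx : x ∈ S') : b = b' := by
  by_contra hbb
  have hTS' := hTS' hbb
  have hSS := h.disjoint hm hK h' hbb
  rcases h.exists_path_avoiding hm hK h' hbb with ⟨a, Q, ha, p, hQ, hd⟩ | ⟨a, Q, ha, p, hQ, hd⟩
  · exact h.not_bridge_of_path hm hK h' hSS hs q hTS hTS' hwx hx ha p hQ hd
  -- The root path leads to the other blossom, so the bridge is reversed: it now starts at `x` and
  -- its last `K`-edge enters `S` at `s`.
  · have hxT : x ∉ T := fun h => Set.disjoint_left.1 hTS' h hx
    obtain ⟨x', R, r1, r2, r3, r4⟩ := q.append_reverse hm hK (.nil (b := x)) (hK _ _ hwx)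
      (Set.disjoint_singleton_left.2 hxT)
    refine h'.not_bridge_of_path hm hK h hSS.symm hx r1 ?_ ?_ r3 hs ha p hQ hd
    · intro z hz hz'
      rcases r2 hz with hz | hz
      · exact hz
      · exact absurd hz' (Set.disjoint_left.1 hTS' hz.1)
    · refine Set.disjoint_left.2 fun z hz hz' => ?_
      rcases r2 hz with hz | hz
      · exact Set.disjoint_left.1 hSS hz' (Set.mem_singleton_iff.1 hz ▸ hx)
      · exact hz.2 (hTS z hz.1 hz')

theorem IsBlossom.union (h : IsBlossom K m b S) (h' : IsBlossom K m b S') :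
    IsBlossom K m b (S ∪ S') := by
  refine ⟨h.1, .inl h.2.1, ?_⟩
  rintro u (hu | hu)
  · obtain ⟨T, hT, p⟩ := h.2.2 u hu
    exact ⟨T, fun z hz => .inl (hT hz), p⟩
  · obtain ⟨T, hT, p⟩ := h'.2.2 u hu
    exact ⟨T, fun z hz => .inr (hT hz), p⟩

/-- Adding an ear to a blossom. -/
theorem IsBlossom.union_ear (hm : ∀ v, m (m v) = v) (hK : ∀ x y, K x y → K y x)
    (h : IsBlossom K m b S) (hs : s ∈ S) (hx : x ∈ S) (q : EvenPath K m s w T)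
    (hTS : ∀ z ∈ T, z ∈ S → z = s) (hwx : K w x) : IsBlossom K m b (S ∪ T) := by
  refine ⟨h.1, .inl h.2.1, ?_⟩
  rintro y (hy | hy)
  · obtain ⟨T, hT, p⟩ := h.2.2 y hy
    exact ⟨T, fun z hz => .inl (hT hz), p⟩
  -- An ear vertex is reached forwards from `s`, or backwards from `x` along the reversed end of the
  -- ear.
  · rcases q.split hy with ⟨T', hT', q'⟩ | ⟨hys, T', hT', q', hyT', hsT'⟩
    · obtain ⟨T₁, hT₁, p⟩ := h.2.2 s hs
      exact ⟨_, Set.union_subset_union hT₁ hT',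
        p.trans q' fun z hz hz' => hTS z (hT' hz') (hT₁ hz)⟩
    · obtain ⟨T₁, hT₁, p⟩ := h.2.2 x hx
      obtain ⟨hmy, -, hne⟩ := q.mate_mem hm hy hys
      obtain ⟨x', R, r1, r2, r3, r4⟩ := q'.append_reverse hm hK p (hK _ _ hwx)
        (Set.disjoint_left.2 fun z hz hz' => hsT' (hTS z (hT' hz') (hT₁ hz) ▸ hz'))
      have hyR : y ∉ R := fun hyR => (r2 hyR).elim
        (fun h => hys (hTS y hy (hT₁ h))) (fun h => hyT' h.1)
      have p' := r1.snoc r3 r4 (by rwa [hm]) (by rw [hm]; exact hne.symm)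
      rw [hm] at p'
      refine ⟨_, ?_, p'⟩
      rintro z (rfl | rfl | hz)
      · exact .inr hmy
      · exact .inr hy
      · exact (r2 hz).elim (fun h => .inl (hT₁ h)) fun h => .inr (hT' h.1)

/-- If no fixed point is oddly reachable, the blossoms cover all evenly reachable vertices. -/
theorem EvenReachable.exists_isBlossom (hm : ∀ v, m (m v) = v) (hK : ∀ x y, K x y → K y x)
    (hno : ∀ v, m v = v → ¬ OddReachable K m v) (hu : EvenReachable K m u) :
    ∃ b S, IsBlossom K m b S ∧ u ∈ S := by
  have hU : ∀ y, y ∈ {u | ∃ b S, IsBlossom K m b S ∧ u ∈ S} →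
      m y ∉ {u | ∃ b S, IsBlossom K m b S ∧ u ∈ S} → ¬ OddReachable K m y := by
    rintro y ⟨b, S, h, hy⟩ hmy hodd
    exact hmy ⟨b, S, h, (h.mate_mem hm hy fun e => h.1.2 (e ▸ hodd)).1⟩
  have hroot : ∀ a, m a = a → ∃ b S, IsBlossom K m b S ∧ a ∈ S := fun a ha =>
    ⟨a, {a}, IsBase.isBlossom ⟨⟨a, _, ha, .nil⟩, hno a ha⟩, rfl⟩
  obtain ⟨a, Q, ha, p⟩ := hu
  induction p with
  | nil => exact hroot a ha
  | @snoc x y Q p h1 h2 h3 h4 ih =>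
    have hev : EvenReachable K m (m y) := ⟨a, _, ha, p.snoc h1 h2 h3 h4⟩
    by_cases hodd : OddReachable K m (m y)
    · by_contra hmy
      have hy : ¬ ∃ b S, IsBlossom K m b S ∧ y ∈ S := fun hy => hU y hy hmy ⟨a, x, Q, ha, p, h1, h2⟩
      -- As `y` is evenly reachable too, the last stretch of a path to it outside all blossoms,
      -- closed by the edge from `y` to `x`, is an ear whose two ends lie in blossoms with the same
      -- base. Adding the ear puts `y` into a blossom.
      obtain ⟨a', Q', ha', p'⟩ := hodd.mate hm (by rw [hm]; exact h4.symm)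
      rw [hm] at p'
      obtain ⟨s, ⟨b, S, hS, hs⟩, T, -, q, hT⟩ := p'.exists_last_mem ha' (hroot a' ha') hU hy
      obtain ⟨b', S', hS', hx⟩ := ih
      have hTS : ∀ z ∈ T, z ∈ S → z = s := fun z hz hzS => hT z hz ⟨b, S, hS, hzS⟩
      have hTS' : ∀ z ∈ T, z ∈ S' → z = s := fun z hz hzS => hT z hz ⟨b', S', hS', hzS⟩
      obtain rfl := hS.base_eq_of_bridge hm hK hS' hs q hTS (fun hbb =>
        Set.disjoint_left.2 fun z hz hz' => Set.disjoint_left.1 (hS.disjoint hm hK hS' hbb) hs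
          (hTS' z hz hz' ▸ hz')) (hK _ _ h1) hx
      refine hy ⟨b, _, (hS.union hS').union_ear hm hK (.inl hs) (.inr hx) q ?_ (hK _ _ h1),
        .inr q.end_mem⟩
      rintro z hz (hz' | hz')
      exacts [hTS z hz hz', hTS' z hz hz']
    · exact ⟨m y, _, IsBase.isBlossom ⟨hev, hodd⟩, rfl⟩

/-! ### Adding edges that create no new oddly reachable vertices -/

/-- If enlarging `K` to `K'` creates no new oddly reachable vertices, then a `K'`-neighbour `v` of a
blossom lies in a blossom with the same base, or it is oddly but not evenly reachable. -/
theorem IsBlossom.neighbor (hm : ∀ v, m (m v) = v) (hK : ∀ x y, K x y → K y x)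
    (hK' : ∀ x y, K' x y → K' y x) (hKK : ∀ x y, K x y → K' x y)
    (hno : ∀ v, m v = v → ¬ OddReachable K m v)
    (hodd : ∀ v, OddReachable K' m v → OddReachable K m v)
    (h : IsBlossom K m b S) (hu : u ∈ S) {v : V} (huv : K' u v) :
    (OddReachable K m v ∧ ¬ EvenReachable K m v) ∨ ∃ S', IsBlossom K m b S' ∧ v ∈ S' := by
  have lift : ∀ b S, IsBlossom K m b S → IsBlossom K' m b S := fun b S h =>
    ⟨⟨h.1.1.mono hKK, fun h1 => h.1.2 (hodd _ h1)⟩, h.2.1, fun u hu => by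
      obtain ⟨T, hT, p⟩ := h.2.2 u hu
      exact ⟨T, hT, p.mono hKK⟩⟩
  by_cases hv : EvenReachable K m v
  · obtain ⟨b', S', hS', hv⟩ := hv.exists_isBlossom hm hK hno
    by_cases hbb : b = b'
    · subst hbb; exact .inr ⟨S', hS', hv⟩
    · refine absurd ((lift _ _ h).base_eq_of_bridge hm hK' (lift _ _ hS') hu .nil (by simp)
        (fun _ => ?_) huv hv) hbb
      exact (h.disjoint hm hK hS' hbb).mono_left (by simpa using hu)
  · refine .inl ⟨?_, hv⟩
    obtain ⟨a, Q, ha, p⟩ := h.evenReachable hm hK hu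
    by_cases hvQ : v ∈ Q
    · exact (p.mem_reachable ha hvQ).resolve_left hv
    · exact hodd v ⟨a, u, Q, ha, p.mono hKK, huv, hvQ⟩

/-- If no fixed point is oddly reachable for `K`, and no single `L`-edge, added to `K`, creates new
oddly reachable vertices, then no fixed point is oddly reachable for `L`. -/
theorem not_oddReachable_of_forall_edge {L : V → V → Prop}
    (hm : ∀ v, m (m v) = v) (hK : ∀ x y, K x y → K y x)
    (hno : ∀ v, m v = v → ¬ OddReachable K m v)
    (hL : ∀ x y, L x y → x ≠ y → y ≠ m x → ∃ K' : V → V → Prop, K' x y ∧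
      (∀ x y, K' x y → K' y x) ∧ (∀ x y, K x y → K' x y) ∧
      ∀ v, OddReachable K' m v → OddReachable K m v)
    {v : V} (hv : m v = v) : ¬ OddReachable L m v := by
  have step : ∀ {a x y b Q S}, m a = a → EvenPath L m a x Q → L x y → y ∉ Q →
      IsBlossom K m b S → x ∈ S →
      (OddReachable K m y ∧ ¬ EvenReachable K m y) ∨ ∃ S', IsBlossom K m b S' ∧ y ∈ S' := by
    intro a x y b Q S ha p hxy hy h hx
    obtain ⟨K', h1, h2, h3, h4⟩ := hL x y hxy (fun e => hy (e ▸ p.end_mem))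
      (fun e => hy (e ▸ p.mate_mem_of_root hm ha p.end_mem))
    exact h.neighbor hm hK h2 h3 hno h4 hx h1
  -- Requiring the base to lie on the path makes a newly visited `y` different from it, so the mate
  -- of `y` stays in the same blossom.
  have key : ∀ {a u Q}, m a = a → EvenPath L m a u Q → ∃ b ∈ Q, ∃ S, IsBlossom K m b S ∧ u ∈ S := by
    intro a u Q ha p
    induction p with
    | nil => exact ⟨a, rfl, {a}, IsBase.isBlossom ⟨⟨a, _, ha, .nil⟩, hno a ha⟩, rfl⟩
    | @snoc x y Q p h1 h2 h3 h4 ih =>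
      obtain ⟨b, hb, S, h, hx⟩ := ih
      rcases step ha p h1 h2 h hx with ⟨hodd, hev⟩ | ⟨S', h', hy⟩
      -- Here `m y` is itself a base: if it were oddly reachable, its mate `y` would be evenly
      -- reachable.
      · refine ⟨m y, by simp, {m y}, IsBase.isBlossom ⟨hodd.mate hm h4, fun hodd' => hev ?_⟩, rfl⟩
        have := hodd'.mate hm (by rw [hm]; exact h4.symm)
        rwa [hm] at this
      · exact ⟨b, by simp [hb], S', h', (h'.mate_mem hm hy fun e => h2 (e ▸ hb)).1⟩
  rintro ⟨a, x, Q, ha, p, hxv, hvQ⟩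
  obtain ⟨b, hb, S, h, hx⟩ := key ha p
  rcases step ha p hxv hvQ h hx with ⟨-, hev⟩ | ⟨S', h', hv'⟩
  · exact hev ⟨v, _, hv, .nil⟩
  · exact (h'.mate_mem hm hv' fun e => hvQ (e ▸ hb)).2.2 hv

end Blossom

/-! ### Matchings as involutions, and augmentation -/

section Translation

variable {V : Type*} {G : SimpleGraph V} {E F : Set (Sym2 V)} {m : V → V}

theorem SimpleGraph.Subgraph.IsMatching.exists_mate {F : G.Subgraph} (hF : F.IsMatching) :
    ∃ m : V → V, (∀ v, m (m v) = v) ∧ ∀ u v, F.Adj u v ↔ m u = v ∧ u ≠ v := by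
  classical
  have h : ∀ v, ∃ w, (v ∈ F.verts → F.Adj v w) ∧ (v ∉ F.verts → w = v) := fun v => by
    by_cases hv : v ∈ F.verts
    · obtain ⟨w, hw, -⟩ := hF hv
      exact ⟨w, fun _ => hw, fun h => absurd hv h⟩
    · exact ⟨v, fun h => absurd h hv, fun _ => rfl⟩
  choose m h1 h2 using h
  refine ⟨m, fun v => ?_, fun u v => ⟨fun h => ?_, fun ⟨h, hne⟩ => ?_⟩⟩
  · by_cases hv : v ∈ F.verts
    · exact hF.eq_of_adj_left (h1 _ (h1 v hv).snd_mem) (h1 v hv).symm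
    · rw [h2 v hv, h2 v hv]
  · exact ⟨hF.eq_of_adj_left (h1 u h.fst_mem) h, h.ne⟩
  · by_cases hu : u ∈ F.verts
    · exact h ▸ h1 u hu
    · exact absurd ((h2 u hu).symm.trans h) hne

theorem exists_isMatching_of_involution (hm : ∀ v, m (m v) = v)
    (hG : ∀ v, m v ≠ v → G.Adj v (m v)) :
    ∃ M : G.Subgraph, M.IsMatching ∧ ∀ u v, M.Adj u v ↔ m u = v ∧ u ≠ v := by
  let M : G.Subgraph :=
    { verts := {v | m v ≠ v}
      Adj := fun u v => m u = v ∧ u ≠ v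
      adj_sub := by
        rintro u v ⟨rfl, h⟩
        exact hG u h.symm
      edge_vert := by
        rintro u v ⟨rfl, h⟩
        exact h.symm
      symm := ⟨by
        rintro u v ⟨rfl, h⟩
        exact ⟨hm u, h.symm⟩⟩ }
  refine ⟨M, fun v hv => ?_, fun u v => Iff.rfl⟩
  exact ⟨m v, ⟨rfl, fun h => hv h.symm⟩, fun w hw => hw.1.symm⟩

theorem SimpleGraph.Subgraph.IsMatching.two_mul_ncard_edgeSet [Finite V] {M : G.Subgraph}
    (hM : M.IsMatching) : 2 * M.edgeSet.ncard = M.verts.ncard := by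
  classical
  have := Fintype.ofFinite V
  have h := M.spanningCoe.sum_degrees_eq_twice_card_edges
  have hE : M.edgeSet.ncard = M.spanningCoe.edgeFinset.card := by
    rw [← Set.ncard_coe_finset, SimpleGraph.coe_edgeFinset, SimpleGraph.Subgraph.edgeSet_spanningCoe]
  rw [hE, ← h]
  have hd : ∀ v, M.spanningCoe.degree v = if v ∈ M.verts then 1 else 0 := by
    intro v
    rw [SimpleGraph.Subgraph.degree_spanningCoe]
    split_ifs with hv
    · exact SimpleGraph.Subgraph.isMatching_iff_forall_degree.1 hM v hv
    · exact SimpleGraph.Subgraph.degree_of_notMem_verts hv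
  simp only [hd, Finset.sum_boole, Nat.cast_id]
  rw [← Set.ncard_coe_finset]
  congr
  ext; simp

theorem two_mul_ncard_edgeSet_add_ncard_fixed [Finite V] {M : G.Subgraph} (hM : M.IsMatching)
    (h : ∀ u v, M.Adj u v ↔ m u = v ∧ u ≠ v) :
    2 * M.edgeSet.ncard + {v | m v = v}.ncard = Nat.card V := by
  have : {v | m v = v} = M.vertsᶜ := by
    ext v
    rw [Set.mem_compl_iff, Set.mem_ofPred_eq, ← not_iff_not, not_not]
    refine ⟨fun hv => ((h v (m v)).2 ⟨rfl, fun e => hv e.symm⟩).fst_mem, fun hv e => ?_⟩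
    obtain ⟨w, hw, -⟩ := hM hv
    obtain ⟨h1, h2⟩ := (h v w).1 hw
    exact h2 (e.symm.trans h1)
  rw [hM.two_mul_ncard_edgeSet, this, Set.ncard_add_ncard_compl]

/-- Matching a fixed point `x` with another vertex `y`, whose former mate becomes a fixed point. -/
theorem exists_rematch [DecidableEq V] (hm : ∀ v, m (m v) = v)
    (hG : ∀ v, m v ≠ v → G.Adj v (m v)) {x y : V} (hx : m x = x) (hxy : G.Adj x y) :
    ∃ m' : V → V, (∀ v, m' (m' v) = v) ∧ (∀ v, m' v ≠ v → G.Adj v (m' v)) ∧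
      (∀ v, v ≠ x → v ≠ y → v ≠ m y → m' v = m v) ∧ m' x = y ∧ m' y = x ∧
      (m y ≠ y → m' (m y) = m y) := by
  have hne := hxy.ne
  have h1 : m y ≠ x := fun e => hne (by rw [← hx, ← e, hm])
  refine ⟨fun z => if z = x then y else if z = y then x else if z = m y then m y else m z,
    fun v => ?_, fun v => ?_, fun v a b c => by simp [a, b, c], by simp, by simp [hne.symm],
    fun h => by simp [h, h1]⟩
  · by_cases a : v = x
    · simp [a, hne.symm]
    by_cases b : v = y
    · simp [b, hne.symm]
    by_cases c : v = m y
    · have c' : m y ≠ y := c ▸ b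
      simp [c, h1, c']
    · have d1 : m v ≠ x := fun e => a (by rw [← hm v, e, hx])
      have d2 : m v ≠ y := fun e => c (by rw [← e, hm])
      have d3 : m v ≠ m y := fun e => b (by rw [← hm v, e, hm])
      simp [a, b, c, d1, d2, d3, hm]
  · by_cases a : v = x
    · simp [a, hxy]
    by_cases b : v = y
    · simp [b, hne.symm, hxy.symm]
    by_cases c : v = m y
    · have c' : m y ≠ y := c ▸ b
      simp [c, h1, c']
    · simpa [a, b, c] using hG v

/-- Shifting a matching along an even alternating path. -/
theorem EvenPath.exists_shift [Finite V] {K : V → V → Prop} {a u : V} {S : Set V}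
    (hm : ∀ v, m (m v) = v) (hG : ∀ v, m v ≠ v → G.Adj v (m v)) (hK : ∀ x y, K x y → G.Adj x y)
    (ha : m a = a) (h : EvenPath K m a u S) :
    ∃ m' : V → V, (∀ v, m' (m' v) = v) ∧ (∀ v, m' v ≠ v → G.Adj v (m' v)) ∧
      (∀ v, v ∉ S → m' v = m v) ∧ m' u = u ∧ {v | m' v = v}.ncard = {v | m v = v}.ncard := by
  classical
  induction h with
  | nil => exact ⟨m, hm, hG, fun _ _ => rfl, ha, rfl⟩
  | @snoc x y S h h1 h2 h3 h4 ih =>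
    obtain ⟨m₁, a1, a2, a3, a4, a5⟩ := ih
    have hy : m₁ y = m y := a3 y h2
    obtain ⟨m₂, b1, b2, b3, b4, b5, b6⟩ := exists_rematch a1 a2 a4 (hK _ _ h1)
    rw [hy] at b3 b6
    have hx := h.end_mem
    have hxy : x ≠ y := fun e => h2 (e ▸ hx)
    refine ⟨m₂, b1, b2, fun v hv => ?_, b6 h4, ?_⟩
    · simp only [Set.mem_insert_iff, not_or] at hv
      rw [b3 v (fun e => hv.2.2 (e ▸ hx)) hv.1 hv.2.1, a3 v hv.2.2]
    · rw [← a5]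
      have e : {v | m₂ v = v} = insert (m y) ({v | m₁ v = v} \ {x}) := by
        ext v
        simp only [Set.mem_ofPred_eq, Set.mem_insert_iff, Set.mem_sdiff, Set.mem_singleton_iff]
        by_cases c1 : v = x
        · subst c1
          have : v ≠ m y := fun e => h3 (e ▸ hx)
          simp [b4, hxy.symm, this]
        by_cases c2 : v = y
        · subst c2; simp [b5, hy, hxy, h4, h4.symm]
        by_cases c3 : v = m y
        · subst c3; simp [b6 h4]
        · simp [b3 v c1 c2 c3, c1, c3]
      have ha4 : x ∈ {v | m₁ v = v} := a4
      rw [e, Set.ncard_insert_of_notMem, Set.ncard_sdiff_singleton_add_one ha4 (Set.toFinite _)]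
      · rintro ⟨h, -⟩
        have h : m₁ (m y) = m y := h
        rw [← hy, a1, hy] at h
        exact h4 h.symm

/-- A maximum matching admits no augmenting path. -/
theorem IsMaximumMatching.not_oddReachable [Finite V] {F : G.Subgraph} (hF : IsMaximumMatching F)
    {K : V → V → Prop} (hm : ∀ v, m (m v) = v) (hFm : ∀ u v, F.Adj u v ↔ m u = v ∧ u ≠ v)
    (hK : ∀ x y, K x y → G.Adj x y) {v : V} (hv : m v = v) : ¬ OddReachable K m v := by
  classical
  rintro ⟨a, x, S, ha, p, hxv, hvS⟩
  have hG : ∀ v, m v ≠ v → G.Adj v (m v) := fun v h => ((hFm v _).2 ⟨rfl, h.symm⟩).adj_sub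
  obtain ⟨m₁, a1, a2, a3, a4, a5⟩ := p.exists_shift hm hG hK ha
  have hy : m₁ v = v := (a3 v hvS).trans hv
  obtain ⟨m₂, b1, b2, b3, b4, b5, -⟩ := exists_rematch a1 a2 a4 (hK _ _ hxv)
  obtain ⟨M, hM, hMm⟩ := exists_isMatching_of_involution b1 b2
  have c1 := two_mul_ncard_edgeSet_add_ncard_fixed hM hMm
  have c2 := two_mul_ncard_edgeSet_add_ncard_fixed hF.1 hFm
  have c3 := hF.2 M hM
  -- The shift moves the root from `a` to `x`; matching `x` with the root `v` removes both from the
  -- fixed points and adds none.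
  have hlt : {v | m₂ v = v}.ncard < {v | m₁ v = v}.ncard := by
    refine Set.ncard_lt_ncard ⟨fun z hz => ?_, fun h => ?_⟩ (Set.toFinite _)
    · have hz : m₂ z = z := hz
      have z1 : z ≠ x := fun e => (hK _ _ hxv).ne (by rw [← e, ← hz, e, b4])
      have z2 : z ≠ v := fun e => (hK _ _ hxv).ne (by rw [← b5, ← e, hz])
      have := b3 z z1 z2 (by rwa [hy])
      exact this.symm.trans hz
    · have : m₂ x = x := h a4
      exact (hK _ _ hxv).ne (this.symm.trans b4)
  omega

/-! ### Dictionary between walks and even paths -/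

theorem isAlternatingPath_concat_iff {a v w : V} (p : (⊤ : SimpleGraph V).Walk a v)
    (h : (⊤ : SimpleGraph V).Adj v w) :
    IsAlternatingPath E F (p.concat h) ↔ IsAlternatingPath E F p ∧ w ∉ p.support ∧
      (Even p.length → s(v, w) ∈ E) ∧ (Odd p.length → s(v, w) ∈ F) := by
  unfold IsAlternatingPath
  rw [SimpleGraph.Walk.concat_isPath_iff]
  simp only [SimpleGraph.Walk.edges_concat]
  constructor
  · rintro ⟨⟨h1, h2⟩, h3⟩
    refine ⟨⟨h1, fun i hi => ?_⟩, h2, ?_⟩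
    · have := h3 i (by simp at hi ⊢; omega)
      simpa only [List.concat_eq_append, List.getElem_append_left hi] using this
    · have := h3 p.length (by simp)
      simpa [List.getElem_append] using this
  · rintro ⟨⟨h1, h2⟩, h3, h4⟩
    refine ⟨⟨h1, h3⟩, fun i hi => ?_⟩
    by_cases hlt : i < p.edges.length
    · simpa only [List.concat_eq_append, List.getElem_append_left hlt] using h2 i hlt
    · have : i = p.edges.length := by simp at hi hlt ⊢; omega
      subst this
      simpa [List.getElem_append] using h4

/-- `EvenPath.snoc` adds two edges at once while a walk grows by one, so the induction carries both
parities; the odd case remembers the pending `K`-edge and the exact support. -/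
theorem IsAlternatingPath.evenPath_or (hF : ∀ u v, s(u, v) ∈ F ↔ m u = v ∧ u ≠ v) {a v : V}
    (p : (⊤ : SimpleGraph V).Walk a v) :
    IsAlternatingPath E F p →
      (Even p.length → EvenPath (fun x y => s(x, y) ∈ E) m a v {z | z ∈ p.support}) ∧
      (Odd p.length → ∃ x S, EvenPath (fun x y => s(x, y) ∈ E) m a x S ∧ s(x, v) ∈ E ∧ v ∉ S ∧
        {z | z ∈ p.support} = insert v S) := by
  induction p using SimpleGraph.Walk.concatRec with
  | Hnil => simpa using fun _ => EvenPath.nil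
  | @Hconcat a v w p h ih =>
    rw [isAlternatingPath_concat_iff]
    rintro ⟨h1, h2, h3, h4⟩
    obtain ⟨i1, i2⟩ := ih h1
    have hsupp : {z | z ∈ (p.concat h).support} = insert w {z | z ∈ p.support} := by
      ext; simp [SimpleGraph.Walk.support_concat, or_comm]
    rw [hsupp, SimpleGraph.Walk.length_concat]
    constructor
    · intro he
      have ho : Odd p.length := by
        rw [← Nat.not_even_iff_odd]; exact Nat.even_add_one.1 he
      obtain ⟨x, S, j1, j2, j3, j4⟩ := i2 ho
      obtain ⟨rfl, k2⟩ := (hF v w).1 (h4 ho)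
      have h2 : m v ∉ {z | z ∈ p.support} := h2
      rw [j4] at h2 ⊢
      rw [Set.insert_comm]
      exact j1.snoc j2 j3 (fun h => h2 (.inr h)) k2.symm
    · intro ho
      have he : Even p.length := by
        rw [← Nat.not_odd_iff_even]; exact Nat.odd_add_one.1 ho
      exact ⟨v, _, i1 he, h3 he, h2, rfl⟩

theorem EvenPath.exists_walk (hF : ∀ u v, s(u, v) ∈ F ↔ m u = v ∧ u ≠ v) {a u : V} {S : Set V}
    (h : EvenPath (fun x y => s(x, y) ∈ E) m a u S) :
    ∃ p : (⊤ : SimpleGraph V).Walk a u, IsAlternatingPath E F p ∧ Even p.length ∧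
      ∀ z, z ∈ p.support ↔ z ∈ S := by
  induction h with
  | nil => exact ⟨.nil, ⟨by simp, by simp⟩, by simp, by simp⟩
  | @snoc x y S h h1 h2 h3 h4 ih =>
    obtain ⟨p, p1, p2, p3⟩ := ih
    have hx := h.end_mem
    have hxy : (⊤ : SimpleGraph V).Adj x y := fun e => h2 (e ▸ hx)
    have hym : (⊤ : SimpleGraph V).Adj y (m y) := h4.symm
    refine ⟨(p.concat hxy).concat hym, ?_, ?_, ?_⟩
    · rw [isAlternatingPath_concat_iff, isAlternatingPath_concat_iff]
      have o : Odd (p.concat hxy).length := by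
        rw [SimpleGraph.Walk.length_concat]; exact p2.add_one
      refine ⟨⟨p1, by rwa [p3], fun _ => h1, fun h => ?_⟩, ?_, fun h => ?_, fun _ => ?_⟩
      · exact absurd p2 (Nat.not_even_iff_odd.2 h)
      · simp [SimpleGraph.Walk.support_concat, p3, h3, h4]
      · exact absurd o (Nat.not_odd_iff_even.2 h)
      · exact (hF _ _).2 ⟨rfl, h4.symm⟩
    · simpa [SimpleGraph.Walk.length_concat, Nat.even_add_one] using p2
    · intro z
      simp only [SimpleGraph.Walk.support_concat, List.mem_append, p3, List.mem_singleton,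
        Set.mem_insert_iff]
      tauto

theorem notMem_coveredVerts_iff (hF : ∀ u v, s(u, v) ∈ F ↔ m u = v ∧ u ≠ v) {v : V} :
    v ∉ coveredVerts F ↔ m v = v := by
  rw [← not_iff_not, not_not]
  constructor
  · rintro ⟨e, he, hv⟩ h
    obtain ⟨w, rfl⟩ := Sym2.mem_iff_exists.1 hv
    obtain ⟨h1, h2⟩ := (hF _ _).1 he
    exact h2 (h.symm.trans h1)
  · exact fun h => ⟨s(v, m v), (hF _ _).2 ⟨rfl, fun e => h e.symm⟩, Sym2.mem_mk_left _ _⟩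

theorem mem_oddReach_iff (hF : ∀ u v, s(u, v) ∈ F ↔ m u = v ∧ u ≠ v) {v : V} :
    v ∈ oddReach E F ↔ OddReachable (fun x y => s(x, y) ∈ E) m v := by
  constructor
  · rintro ⟨a, ha, p, hp, ho⟩
    obtain ⟨x, S, h1, h2, h3, -⟩ := (hp.evenPath_or hF p).2 ho
    exact ⟨a, x, S, (notMem_coveredVerts_iff hF).1 ha, h1, h2, h3⟩
  · rintro ⟨a, x, S, ha, h1, h2, h3⟩
    obtain ⟨p, p1, p2, p3⟩ := h1.exists_walk hF
    have hxv : (⊤ : SimpleGraph V).Adj x v := fun e => h3 (e ▸ h1.end_mem)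
    refine ⟨a, (notMem_coveredVerts_iff hF).2 ha, p.concat hxv, ?_, ?_⟩
    · rw [isAlternatingPath_concat_iff]
      exact ⟨p1, by rwa [p3], fun _ => h2, fun h => absurd p2 (Nat.not_even_iff_odd.2 h)⟩
    · rw [SimpleGraph.Walk.length_concat]; exact p2.add_one

end Translation

theorem mainTheorem2 {V : Type*} [Finite V] (G : SimpleGraph V) (F : G.Subgraph)
    (hF : IsMaximumMatching F) {x y : V} (P : (⊤ : SimpleGraph V).Walk x y)
    (hP : IsAugmentingPath F.edgeSet P) :
    ∃ e ∈ P.edges, IsEnriching (G.edgeSet \ F.edgeSet) F.edgeSet e := by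
  obtain ⟨m, hm, hFm⟩ := hF.1.exists_mate
  have hFe : ∀ u v, s(u, v) ∈ F.edgeSet ↔ m u = v ∧ u ≠ v := fun u v => by
    rw [SimpleGraph.Subgraph.mem_edgeSet, hFm]
  obtain ⟨⟨hpath, halt⟩, hpos, hx, hy⟩ := hP
  have hy' := (notMem_coveredVerts_iff hFe).1 hy
  -- With even positive length the last edge, at the odd index `k`, would be in `F` and cover `y`.
  have hodd : Odd P.length := by
    rw [← Nat.not_even_iff_odd]
    intro he
    obtain ⟨k, hk⟩ : ∃ k, P.length = k + 1 := ⟨P.length - 1, by omega⟩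
    have h := (halt k (by rw [SimpleGraph.Walk.length_edges]; omega)).2
      (by rw [← Nat.not_even_iff_odd]; exact Nat.even_add_one.1 (hk ▸ he))
    refine hy ⟨_, h, ?_⟩
    rw [SimpleGraph.Walk.getElem_edges]
    simp [← hk]
  have hP' : IsAlternatingPath {e | e ∈ P.edges} F.edgeSet P :=
    ⟨hpath, fun i hi => ⟨fun _ => List.getElem_mem hi, (halt i hi).2⟩⟩
  by_contra! hne
  -- `L` consists of all edges of `P`, including those in `F`; only its non-matching edges have to
  -- be tested for enrichment.
  refine not_oddReachable_of_forall_edge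
    (K := fun x y => s(x, y) ∈ G.edgeSet \ F.edgeSet) (L := fun x y => s(x, y) ∈ {e | e ∈ P.edges})
    hm (fun x y h => (Sym2.eq_swap (a := x) (b := y)) ▸ h) (fun v hv => ?_) (fun u v huv hne' hmate => ?_) hy' ?_
  · exact hF.not_oddReachable hm hFm (fun x y h => h.1) hv
  · refine ⟨fun x y => s(x, y) ∈ G.edgeSet \ F.edgeSet ∪ {s(u, v)}, .inr rfl,
      fun x y h => (congrArg (· ∈ _) (Sym2.eq_swap (a := x) (b := y))).mp h, fun x y h => .inl h, fun w hw => ?_⟩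
    by_contra hw'
    -- Enlarging `K` never loses oddly reachable vertices, so a single new one makes the inclusion
    -- strict.
    refine hne s(u, v) huv ⟨hne', fun h => hmate ((hFe _ _).1 h).1.symm, fun z hz => ?_, fun h => ?_⟩
    · rw [mem_oddReach_iff hFe] at hz ⊢
      exact hz.mono fun _ _ h => .inl h
    · exact hw' ((mem_oddReach_iff hFe).1 (h ((mem_oddReach_iff hFe).2 hw)))
  · exact (mem_oddReach_iff hFe).1 ⟨x, hx, P, hP', hodd⟩
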